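/- Let $\mathbb{T}=\{\langle\rangle\}\cup\{\langle n\rangle:n<\omega\}\cup\{\langle n,i\rangle:i\le n<\omega\}$, a tree of finite sequences ordered by initial segments, and let $\mathbb{T}(n)=\{\langle\rangle,\langle n\rangle\}\cup\{\langle n,i\rangle:i\le n\}$. Let $\mathcal{R}_1$ be the set of all subtrees $X\subseteq\mathbb{T}$ (closed under initial segments) for which there is a strictly increasing sequence $(k_n)_{n<\omega}$ such that $X\cap\mathbb{T}(k_n)\cong\mathbb{T}(n)$ for each $n$, and whenever $X\cap\mathbb{T}(j)$ contains a node other than the root $\langle\rangle$, then $j=k_n$ for some $n$. (The sequence is unique.) Put $X(n)=X\cap\mathbb{T}(k_n)$, $r_n(X)=\bigcup_{i<n}X(i)$, $\mathcal{AR}_n=\{r_n(X):X\in\mathcal{R}_1\}$ and $\mathcal{AR}=\bigcup_n\mathcal{AR}_n$. For $X,Y\in\mathcal{R}_1$ let $Y\le X$ iff there is a strictly increasing $(k_n)_{n<\omega}$ with $Y(n)\subseteq X(k_n)$ for all $n$. For $a,b\in\mathcal{AR}$ let $b\le_{\mathrm{fin}}a$ iff there are $n\le m$ and $X,Y\in\mathcal{R}_1$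 with $b=r_n(Y)$, $a=r_m(X)$, and $k_0<\dots<k_{n-1}<m$ with $Y(i)\subseteq X(k_i)$ for all $i<n$. For $a\in\mathcal{AR}$ let $|a|$ be the $n$ with $a\in\mathcal{AR}_n$. Write $a\sqsubset b$ iff $a=r_m(A)$ and $b=r_n(A)$ for some $A\in\mathcal{R}_1$ and $m<n$. For $B\in\mathcal{R}_1$ let $[a,B]=\{A\in\mathcal{R}_1:A\le B,\ \exists n\ r_n(A)=a\}$, let $\mathrm{depth}_B(a)$ be the least $n$ with $a\le_{\mathrm{fin}}r_n(B)$ ($\infty$ if there is none), let $[\mathrm{depth}_B(a),B]=[r_n(B),B]$ if $\mathrm{depth}_B(a)=n<\infty$, and let $r_n[a,A]=\{b\in\mathcal{AR}_n:a\sqsubset b,\ \exists m\ b\le_{\mathrm{fin}}r_m(A)\}$. **Theorem.** $\mathcal{R}_1$ is nonempty, $\le$ is a quasi-ordering on $\mathcal{R}_1$, and, identifying $A$ with $(r_n(A))_{n<\omega}$, the set $\mathcal{R}_1$ is closed in $\mathcal{AR}^{\mathbb{N}}$ (product topology, $\mathcal{AR}$ discrete). Moreover the following axioms hold. * **A.1.**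 (1) $r_0(A)=\emptyset$ for all $A$. (2) If $A\ne B$, then $r_n(A)\ne r_n(B)$ for some $n$. (3) If $r_n(A)=r_m(B)$, then $n=m$ and $r_k(A)=r_k(B)$ for all $k<n$. * **A.2.** $\le_{\mathrm{fin}}$ is a quasi-ordering on $\mathcal{AR}$ with: (1) $\{a\in\mathcal{AR}:a\le_{\mathrm{fin}}b\}$ is finite for every $b\in\mathcal{AR}$; (2) $A\le B$ iff for every $n$ there is $m$ with $r_n(A)\le_{\mathrm{fin}}r_m(B)$; (3) for $a,b,c\in\mathcal{AR}$, if $a\sqsubset b$ and $b\le_{\mathrm{fin}}c$, then there is $d\in\mathcal{AR}$ with $d\sqsubset c$ and $a\le_{\mathrm{fin}}d$. * **A.3.** For $a\in\mathcal{AR}$: (1) if $\mathrm{depth}_B(a)<\infty$, then $[a,A]\ne\emptyset$ for all $A\in[\mathrm{depth}_B(a),B]$; (2) if $A\le B$ and $[a,A]\ne\emptyset$, then $\mathrm{depth}_B(a)<\infty$ and there is $A'\in[\mathrm{depth}_B(a),B]$ with $\emptyset\ne[a,A']\subseteq[a,A]$. * **A.4.** For $a\in\mathcal{AR}$, if $\mathrm{depth}_B(a)<\infty$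 and $\mathcal{O}\subseteq\mathcal{AR}_{|a|+1}$, then there is $A\in[\mathrm{depth}_B(a),B]$ with $r_{|a|+1}[a,A]\subseteq\mathcal{O}$ or $r_{|a|+1}[a,A]\subseteq\mathcal{O}^c$. Finally, $(\mathcal{R}_1,\le,r)$ is a topological Ramsey space. That is, give $\mathcal{R}_1$ the Ellentuck topology generated by the sets $[a,B]$ ($a\in\mathcal{AR}$, $B\in\mathcal{R}_1$). Then every $\mathcal{X}\subseteq\mathcal{R}_1$ with the property of Baire ($\mathcal{X}\,\triangle\,\mathcal{O}$ is meager for some open $\mathcal{O}$) is Ramsey: for every $[a,A]\ne\emptyset$ there is $B\in[a,A]$ with $[a,B]\subseteq\mathcal{X}$ or $[a,B]\cap\mathcal{X}=\emptyset$. And every meager $\mathcal{X}\subseteq\mathcal{R}_1$ is Ramsey null: for every $[a,A]\ne\emptyset$ there is $B\in[a,A]$ with $[a,B]\cap\mathcal{X}=\emptyset$. -/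

import Mathlib

/-! ### Triples `(R, ≤, r)` and the axioms A.1 - A.4

`R` is a type, `le` a relation on `R`, and `r : R → ℕ → U` the sequence of approximation maps,
`r A n` being the `n`-th approximation of `A`. The collection `AR` of all finite approximations is
the subset of `U` of all values of `r`. `leFin` is the relation on `AR` that axiom A.2 asks for. -/

namespace RamseySpace

section

variable {R : Type*} {U : Type*}

/-- `AR_n`, the collection of all `n`-th approximations. -/
def ARn (r : R → ℕ → U) (n : ℕ) : Set U := {a | ∃ A : R, r A n = a}

/-- `AR`, the collection of all finite approximations. -/
def AR (r : R → ℕ → U) : Set U := ⋃ n : ℕ, ARn r n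

/-- The length `|a|` of `a ∈ AR`: the `n` with `a ∈ AR_n` (it is unique when A.1 holds). -/
noncomputable def len (r : R → ℕ → U) (a : U) : ℕ := sInf {n : ℕ | a ∈ ARn r n}

/-- `a ⊏ b` on `AR`: `a = r_m(b)` for some `m < |b|`, that is, some `A` has `b = r_n(A)` and
`a = r_m(A)` with `m < n`. -/
def StrictInit (r : R → ℕ → U) (a b : U) : Prop :=
  ∃ (A : R) (m n : ℕ), m < n ∧ r A m = a ∧ r A n = b

/-- `[a, B] = {A ∈ R : A ≤ B and r_n(A) = a for some n}`. -/
def basic (le : R → R → Prop) (r : R → ℕ → U) (a : U) (B : R) : Set R :=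
  {A | le A B ∧ ∃ n : ℕ, r A n = a}

/-- `depth_B(a)`: the least `n` with `a ≤_fin r_n(B)`, and `∞` if there is none. -/
noncomputable def depth (leFin : U → U → Prop) (r : R → ℕ → U) (B : R) (a : U) : ℕ∞ :=
  sInf {d : ℕ∞ | ∃ n : ℕ, d = (n : ℕ∞) ∧ leFin a (r B n)}

/-- `r_n[a, A]`: the collection of all `b ∈ AR_n` with `a ⊏ b` and `b ≤_fin A`, where
`b ≤_fin A` means `b ≤_fin r_m(A)` for some `m`. -/
def rImage (leFin : U → U → Prop) (r : R → ℕ → U) (n : ℕ) (a : U) (A : R) : Set U :=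
  {b | b ∈ ARn r n ∧ StrictInit r a b ∧ ∃ m : ℕ, leFin b (r A m)}

/-- `R` is nonempty and `≤` is a quasi-ordering on it. -/
structure IsQuasiOrdered (le : R → R → Prop) : Prop where
  nonempty : Nonempty R
  refl : ∀ A : R, le A A
  trans : ∀ A B C : R, le A B → le B C → le A C

/-- `R`, identified with the set of sequences `(r_n(A))_n` with `A ∈ R`, is closed in `AR^ℕ`,
where `AR` is discrete and `AR^ℕ` carries the product topology. -/
def IsClosedTriple (r : R → ℕ → U) : Prop :=
  letI : TopologicalSpace (AR r) := ⊥
  IsClosed {f : ℕ → AR r | ∃ A : R, ∀ n : ℕ, (f n : U) = r A n}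

/-- Axiom A.1. -/
structure AxiomA1 [EmptyCollection U] (r : R → ℕ → U) : Prop where
  zero : ∀ A : R, r A 0 = ∅
  sep : ∀ A B : R, A ≠ B → ∃ n : ℕ, r A n ≠ r B n
  init : ∀ (A B : R) (n m : ℕ), r A n = r B m → n = m ∧ ∀ k < n, r A k = r B k

/-- Axiom A.2, for the given relation `≤_fin` on `AR`. -/
structure AxiomA2 (le : R → R → Prop) (leFin : U → U → Prop) (r : R → ℕ → U) : Prop where
  refl : ∀ a ∈ AR r, leFin a a
  trans : ∀ a ∈ AR r, ∀ b ∈ AR r, ∀ c ∈ AR r, leFin a b → leFin b c → leFin a c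
  finite : ∀ b ∈ AR r, {a | a ∈ AR r ∧ leFin a b}.Finite
  le_iff : ∀ A B : R, le A B ↔ ∀ n : ℕ, ∃ m : ℕ, leFin (r A n) (r B m)
  init : ∀ a ∈ AR r, ∀ b ∈ AR r, ∀ c ∈ AR r, StrictInit r a b → leFin b c →
    ∃ d ∈ AR r, StrictInit r d c ∧ leFin a d

/-- Axiom A.3. If `depth_B(a) = n < ∞`, then `[depth_B(a), B]` stands for `[r_n(B), B]`. -/
structure AxiomA3 (le : R → R → Prop) (leFin : U → U → Prop) (r : R → ℕ → U) : Prop where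
  nonempty : ∀ a ∈ AR r, ∀ (B : R) (n : ℕ), depth leFin r B a = n →
    ∀ A ∈ basic le r (r B n) B, (basic le r a A).Nonempty
  amalg : ∀ a ∈ AR r, ∀ A B : R, le A B → (basic le r a A).Nonempty →
    ∃ n : ℕ, depth leFin r B a = n ∧
      ∃ A' ∈ basic le r (r B n) B, (basic le r a A').Nonempty ∧ basic le r a A' ⊆ basic le r a A

/-- Axiom A.4. -/
def AxiomA4 (le : R → R → Prop) (leFin : U → U → Prop) (r : R → ℕ → U) : Prop :=
  ∀ a ∈ AR r, ∀ (B : R) (n : ℕ), depth leFin r B a = n →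
    ∀ O ⊆ ARn r (len r a + 1), ∃ A ∈ basic le r (r B n) B,
      rImage leFin r (len r a + 1) a A ⊆ O ∨ rImage leFin r (len r a + 1) a A ⊆ Oᶜ

/-- The Ellentuck topology on `R`, given by the basic open sets `[a, B]`. -/
@[reducible]
def ellentuck (le : R → R → Prop) (r : R → ℕ → U) : TopologicalSpace R :=
  TopologicalSpace.generateFrom {S | ∃ a ∈ AR r, ∃ B : R, S = basic le r a B}

/-- `S` is meager in the Ellentuck topology. -/
def IsEllentuckMeager (le : R → R → Prop) (r : R → ℕ → U) (S : Set R) : Prop :=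
  @IsMeagre R (ellentuck le r) S

/-- `S` has the property of Baire in the Ellentuck topology: it differs from an open set by a
meager set. -/
def HasBaireProperty (le : R → R → Prop) (r : R → ℕ → U) (S : Set R) : Prop :=
  ∃ O : Set R, @IsOpen R (ellentuck le r) O ∧ IsEllentuckMeager le r (symmDiff S O)

/-- `S` is Ramsey. -/
def IsRamsey (le : R → R → Prop) (r : R → ℕ → U) (S : Set R) : Prop :=
  ∀ a ∈ AR r, ∀ A : R, (basic le r a A).Nonempty →
    ∃ B ∈ basic le r a A, basic le r a B ⊆ S ∨ basic le r a B ∩ S = ∅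

/-- `S` is Ramsey null. -/
def IsRamseyNull (le : R → R → Prop) (r : R → ℕ → U) (S : Set R) : Prop :=
  ∀ a ∈ AR r, ∀ A : R, (basic le r a A).Nonempty →
    ∃ B ∈ basic le r a A, basic le r a B ∩ S = ∅

/-- `(R, ≤, r)` is a topological Ramsey space. -/
structure IsTopologicalRamseySpace (le : R → R → Prop) (r : R → ℕ → U) : Prop where
  ramsey : ∀ S : Set R, HasBaireProperty le r S → IsRamsey le r S
  null : ∀ S : Set R, IsEllentuckMeager le r S → IsRamseyNull le r S

end

/-! ### The space `R_1`

Nodes are finite sequences of natural numbers; `Descriptive.tree ℕ` is Mathlib's collection of all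
sets of finite sequences that are closed under initial segments. -/

/-- The `n`-th subtree `T(n) = {⟨⟩, ⟨n⟩} ∪ {⟨n, i⟩ : i ≤ n}` of `T`. -/
def subT (n : ℕ) : Set (List ℕ) := {[], [n]} ∪ {s | ∃ i : ℕ, i ≤ n ∧ s = [n, i]}

/-- The tree `T = {⟨⟩} ∪ {⟨n⟩ : n} ∪ {⟨n, i⟩ : i ≤ n}` of height two. -/
def fullT : Set (List ℕ) :=
  {[]} ∪ {s | ∃ n : ℕ, s = [n]} ∪ {s | ∃ n i : ℕ, i ≤ n ∧ s = [n, i]}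

/-- Isomorphism of trees of finite sequences: a bijection that preserves and reflects the
initial-segment relation. -/
def TreeIso (S S' : Set (List ℕ)) : Prop :=
  ∃ f : S ≃ S', ∀ x y : S, x.1 <+: y.1 ↔ (f x).1 <+: (f y).1

/-- `(k_n)` is strictly increasing, `X ∩ T(k_n) ≅ T(n)` for all `n`, and every `T(j)` that `X` meets
in a node other than the common root `⟨⟩` of all the `T(j)` has `j = k_n` for some `n`. -/
structure IsIndexing (X : Set (List ℕ)) (k : ℕ → ℕ) : Prop where
  strictMono : StrictMono k
  iso : ∀ n : ℕ, TreeIso (X ∩ subT (k n)) (subT n)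
  cover : ∀ j : ℕ, (∃ s ∈ X ∩ subT j, s ≠ []) → ∃ n : ℕ, j = k n

/-- `R_1`: the subtrees `X` of `T` with the same structure as `T`. -/
def R1 : Type :=
  {X : Set (List ℕ) // X ∈ Descriptive.tree ℕ ∧ X ⊆ fullT ∧ ∃ k : ℕ → ℕ, IsIndexing X k}

/-- The sequence `(k_n)` belonging to a subtree is unique. -/
theorem IsIndexing.unique {X : Set (List ℕ)} {k k' : ℕ → ℕ} (h : IsIndexing X k)
    (h' : IsIndexing X k') : k = k' := by
  have key : ∀ {k k' : ℕ → ℕ}, IsIndexing X k → IsIndexing X k' →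
      Set.range k ⊆ Set.range k' := by
    rintro k k' h h' _ ⟨n, rfl⟩
    obtain ⟨f, -⟩ := h.iso n
    have h0 : ([] : List ℕ) ∈ subT n := Or.inl (Or.inl rfl)
    have h1 : [n] ∈ subT n := Or.inl (Or.inr rfl)
    have hne : f.symm ⟨[], h0⟩ ≠ f.symm ⟨[n], h1⟩ := fun e => by
      simpa using congrArg Subtype.val (f.symm.injective e)
    have hex : ∃ s ∈ X ∩ subT (k n), s ≠ [] := by
      by_contra hcon
      push Not at hcon
      exact hne (Subtype.ext ((hcon _ (f.symm _).2).trans (hcon _ (f.symm _).2).symm))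
    obtain ⟨m, hm⟩ := h'.cover _ hex
    exact ⟨m, hm.symm⟩
  exact (h.strictMono.range_inj h'.strictMono).1 ((key h h').antisymm (key h' h))

namespace R1

/-- The strictly increasing sequence `(k_n)` of `X ∈ R_1`. -/
noncomputable def index (X : R1) : ℕ → ℕ := X.2.2.2.choose

theorem index_spec (X : R1) : IsIndexing X.1 X.index := X.2.2.2.choose_spec

/-- `X(n) = X ∩ T(k_n)`, the `n`-th tree of `X`. -/
def nth (X : R1) (n : ℕ) : Set (List ℕ) := X.1 ∩ subT (X.index n)

/-- `r_n(X) = ⋃_{i < n} X(i)`. -/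
def r (X : R1) (n : ℕ) : Set (List ℕ) := ⋃ i : ℕ, ⋃ _ : i < n, X.nth i

/-- `Y ≤ X`: for a strictly increasing sequence `(k_n)`, each `Y(n)` is a subtree of `X(k_n)`. -/
def le (Y X : R1) : Prop := ∃ k : ℕ → ℕ, StrictMono k ∧ ∀ n : ℕ, Y.nth n ⊆ X.nth (k n)

/-- `b ≤_fin a`: there are `n ≤ m` with `b ∈ AR_n` and `a ∈ AR_m`, and a strictly increasing
sequence `(k_i)_{i < n}` with values below `m`, such that `b(i)` is a subtree of `a(k_i)` for all
`i < n`. Here `b(i) = Y(i)` and `a(j) = X(j)` if `b = r_n(Y)` and `a = r_m(X)`. -/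
def leFin (b a : Set (List ℕ)) : Prop :=
  ∃ (n m : ℕ) (Y X : R1), n ≤ m ∧ b = Y.r n ∧ a = X.r m ∧
    ∃ k : Fin n → Fin m, StrictMono k ∧ ∀ i : Fin n, Y.nth i ⊆ X.nth (k i)

end R1

end RamseySpace

/-! A member of `R1` amounts to a strictly increasing sequence `k` with sets `S n ⊆ {0, …, k n}` of
size `n + 1`: the isomorphism with `T(n)` only fixes the number of leaves (`nth_spec`,
`exists_of_blocks`). Inclusion between two trees forces equal indices, so `≤` and `≤_fin` say just
that every tree of the smaller object lies in some tree of the larger. A.1, A.2 and closedness are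
then bookkeeping. For A.3, the initial trees of one member are continued by subtrees of late trees
of another (`exists_glue`). For A.4, extending `a` by one step means choosing `|a| + 1` leaves in a
single tree beyond the depth of `a`; the finite Ramsey theorem makes parts of late trees
homogeneous, and a colour that occurs infinitely often is kept.

The last assertion is the abstract Ellentuck theorem, derived from closedness and the axioms alone.
Fusion (`exists_fusion`) meets a hereditary requirement for all extensions of `a` by treating, depth
by depth, finitely many approximations at a time. It yields a member that accepts or rejects every
such extension; A.4 propagates rejection to all end-extensions. An open set contains some `[r_n(C),
C]` around each of its points `C`, so rejection of all end-extensions means disjointness. Dense open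
sets can only be decided positively, fusion over countably many of them handles meager sets, and a
set with the property of Baire agrees with an open set on some `[a, C]`. -/

namespace RamseySpace

/-! ### The finite Ramsey theorem. -/

/-- Finite Ramsey theorem for two colours and `k`-element sets. -/
theorem exists_ramsey_number {α : Type*} [DecidableEq α] (k p q : ℕ) :
    ∃ N : ℕ, ∀ (S : Finset α) (c : Finset α → Prop), N ≤ S.card →
      (∃ T ⊆ S, T.card = p ∧ ∀ U ⊆ T, U.card = k → c U) ∨
      (∃ T ⊆ S, T.card = q ∧ ∀ U ⊆ T, U.card = k → ¬ c U) := by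
  induction k generalizing p q with
  | zero =>
    refine ⟨max p q, fun S c hS => ?_⟩
    by_cases hc : c ∅
    · obtain ⟨T, hT, hp⟩ := Finset.exists_subset_card_eq ((le_max_left p q).trans hS)
      refine Or.inl ⟨T, hT, hp, fun U _ hU => ?_⟩
      rwa [Finset.card_eq_zero.1 hU]
    · obtain ⟨T, hT, hp⟩ := Finset.exists_subset_card_eq ((le_max_right p q).trans hS)
      refine Or.inr ⟨T, hT, hp, fun U _ hU => ?_⟩
      rwa [Finset.card_eq_zero.1 hU]
  | succ k ih =>
    induction p generalizing q with
    | zero =>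
      refine ⟨0, fun S c _ => Or.inl ⟨∅, by simp, by simp, fun U hU h => ?_⟩⟩
      simp [Finset.subset_empty.1 hU] at h
    | succ p ihp =>
      induction q with
      | zero =>
        refine ⟨0, fun S c _ => Or.inr ⟨∅, by simp, by simp, fun U hU h => ?_⟩⟩
        simp [Finset.subset_empty.1 hU] at h
      | succ q ihq =>
        obtain ⟨N₁, h₁⟩ := ihp (q + 1)
        obtain ⟨N₂, h₂⟩ := ihq
        obtain ⟨N, hN⟩ := ih N₁ N₂
        -- One point `x` is set aside: `U ↦ c (insert x U)` colours `k`-sets, so `ih` applies to the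
        -- other points.
        refine ⟨N + 1, fun S c hS => ?_⟩
        obtain ⟨x, hx⟩ : S.Nonempty := Finset.card_pos.1 (by omega)
        have hsub : S.erase x ⊆ S := Finset.erase_subset x S
        -- a homogeneous subset for the sections at `x` can be enlarged by `x`
        have key : ∀ (d : Finset α → Prop) (T V : Finset α), T ⊆ S.erase x → V ⊆ T →
            (∀ U ⊆ T, U.card = k → d (insert x U)) → (∀ U ⊆ V, U.card = k + 1 → d U) →
            (insert x V) ⊆ S ∧ (insert x V).card = V.card + 1 ∧
              ∀ U ⊆ insert x V, U.card = k + 1 → d U := by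
          intro d T V hT hV h h'
          have hxV : x ∉ V := fun h => Finset.notMem_erase x S (hT (hV h))
          refine ⟨Finset.insert_subset hx ((hV.trans hT).trans hsub),
            Finset.card_insert_of_notMem hxV, fun U hU hc => ?_⟩
          by_cases hxU : x ∈ U
          · rw [← Finset.insert_erase hxU]
            refine h _ (Finset.Subset.trans ?_ hV) (by rw [Finset.card_erase_of_mem hxU]; omega)
            rwa [← Finset.subset_insert_iff]
          · exact h' U ((Finset.subset_insert_iff_of_notMem hxU).1 hU) hc
        rcases hN (S.erase x) (fun U => c (insert x U))
          (by rw [Finset.card_erase_of_mem hx]; omega) with ⟨T, hT, hTc, h⟩ | ⟨T, hT, hTc, h⟩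
        · rcases h₁ T c hTc.ge with ⟨V, hV, hVc, h'⟩ | ⟨V, hV, hVc, h'⟩
          · obtain ⟨e₁, e₂, e₃⟩ := key c T V hT hV h h'
            exact Or.inl ⟨_, e₁, by rw [e₂, hVc], e₃⟩
          · exact Or.inr ⟨V, hV.trans (hT.trans hsub), hVc, h'⟩
        · rcases h₂ T c hTc.ge with ⟨V, hV, hVc, h'⟩ | ⟨V, hV, hVc, h'⟩
          · exact Or.inl ⟨V, hV.trans (hT.trans hsub), hVc, h'⟩
          · obtain ⟨e₁, e₂, e₃⟩ := key (fun U => ¬ c U) T V hT hV h h'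
            exact Or.inr ⟨_, e₁, by rw [e₂, hVc], e₃⟩

/-! ### Trees of height two with a prescribed leaf set. -/

/-- The copy of a tree `T(n)` inside `T(j)` with set of leaves `{⟨j, i⟩ : i ∈ S}`. -/
def block (j : ℕ) (S : Finset ℕ) : Set (List ℕ) := {[], [j]} ∪ {s | ∃ i ∈ S, s = [j, i]}

theorem nil_mem_block (j : ℕ) (S : Finset ℕ) : [] ∈ block j S := Or.inl (Or.inl rfl)

theorem singleton_mem_block {j j' : ℕ} {S : Finset ℕ} : [j'] ∈ block j S ↔ j' = j := by
  simp [block]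

theorem pair_mem_block {j j' i : ℕ} {S : Finset ℕ} : [j', i] ∈ block j S ↔ j' = j ∧ i ∈ S := by
  simp [block]; grind

theorem subT_eq_block (n : ℕ) : subT n = block n (Finset.range (n + 1)) := by
  simp [subT, block]

theorem block_subset_block {j j' : ℕ} {S S' : Finset ℕ} :
    block j S ⊆ block j' S' ↔ j = j' ∧ S ⊆ S' := by
  constructor
  · intro h
    have hj : j = j' := singleton_mem_block.1 (h (singleton_mem_block.2 rfl))
    exact ⟨hj, fun i hi => (pair_mem_block.1 (h (pair_mem_block.2 ⟨rfl, hi⟩))).2⟩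
  · rintro ⟨rfl, h⟩ s (hs | ⟨i, hi, rfl⟩)
    · exact Or.inl hs
    · exact Or.inr ⟨i, h hi, rfl⟩

theorem block_injective {j j' : ℕ} {S S' : Finset ℕ} (h : block j S = block j' S') :
    j = j' ∧ S = S' :=
  have h₁ := block_subset_block.1 h.subset
  have h₂ := block_subset_block.1 h.superset
  ⟨h₁.1, h₁.2.antisymm h₂.2⟩

theorem block_finite (j : ℕ) (S : Finset ℕ) : (block j S).Finite := by
  refine Set.Finite.union (by simp) ?_
  refine (S.finite_toSet.image fun i => [j, i]).subset ?_
  rintro _ ⟨i, hi, rfl⟩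
  exact ⟨i, hi, rfl⟩

theorem ncard_block (j : ℕ) (S : Finset ℕ) : (block j S).ncard = S.card + 2 := by
  have hS : {s | ∃ i ∈ S, s = [j, i]} = (fun i => [j, i]) '' (S : Set ℕ) := by
    ext s; simp [eq_comm]
  rw [block, hS, Set.ncard_union_eq, Set.ncard_image_of_injective, Set.ncard_coe_finset,
    Set.ncard_pair, add_comm]
  · simp
  · intro a b; simp
  · rw [Set.disjoint_left]; rintro _ (rfl | rfl) <;> simp

/-- The map on nodes that sends `⟨n⟩` to `⟨j⟩` and `⟨n, i⟩` to `⟨j, e i⟩`. -/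
def blockMap (j : ℕ) (e : ℕ → ℕ) : List ℕ → List ℕ
  | [] => []
  | [_] => [j]
  | _ :: i :: _ => [j, e i]

theorem treeIso_block {j j' : ℕ} {S S' : Finset ℕ} (h : S.card = S'.card) :
    TreeIso (block j S) (block j' S') := by
  obtain ⟨e, he⟩ := S.finite_toSet.exists_bijOn_of_encard_eq (t := (S' : Set ℕ))
    (by simp [h])
  have hb : Set.BijOn (blockMap j' e) (block j S) (block j' S') := by
    refine ⟨?_, ?_, ?_⟩
    · rintro _ ((rfl | rfl) | ⟨i, hi, rfl⟩)
      · exact nil_mem_block _ _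
      · exact singleton_mem_block.2 rfl
      · exact pair_mem_block.2 ⟨rfl, he.mapsTo hi⟩
    · rintro _ ((rfl | rfl) | ⟨i, hi, rfl⟩) _ ((rfl | rfl) | ⟨i', hi', rfl⟩) <;>
        simp [blockMap]
      exact fun hii => he.injOn hi hi' hii
    · rintro _ ((rfl | rfl) | ⟨i, hi, rfl⟩)
      · exact ⟨[], nil_mem_block _ _, rfl⟩
      · exact ⟨[j], singleton_mem_block.2 rfl, rfl⟩
      · obtain ⟨i', hi', rfl⟩ := he.surjOn hi
        exact ⟨[j, i'], pair_mem_block.2 ⟨rfl, hi'⟩, rfl⟩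
  refine ⟨hb.equiv _, ?_⟩
  rintro ⟨x, hx⟩ ⟨y, hy⟩
  change x <+: y ↔ blockMap j' e x <+: blockMap j' e y
  rcases hx with (rfl | rfl) | ⟨i, hi, rfl⟩ <;> rcases hy with (rfl | rfl) | ⟨i', hi', rfl⟩ <;>
    simp [blockMap, List.cons_prefix_cons]
  exact (he.injOn.eq_iff hi hi').symm

/-! ### Members of `R1` described by indices and leaf sets. -/

namespace R1

open Classical in
/-- The set of all `i` such that `⟨k_n, i⟩` is a leaf of `X(n)`. -/
noncomputable def leaves (X : R1) (n : ℕ) : Finset ℕ :=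
  (Finset.range (X.index n + 1)).filter fun i => [X.index n, i] ∈ X.1

open Classical in
-- Counting suffices: the isomorphism gives `X.nth n` the `n + 3` nodes of `T(n)`. Hence there is a
-- leaf, closure under initial segments supplies the two nodes below it, and `n + 1` leaves remain.
theorem nth_spec (X : R1) (n : ℕ) :
    X.nth n = block (X.index n) (X.leaves n) ∧ (X.leaves n).card = n + 1 := by
  have htree : ∀ ⦃x : List ℕ⦄ ⦃a : ℕ⦄, x ++ [a] ∈ X.1 → x ∈ X.1 := X.2.1
  have hsub : X.nth n ⊆ block (X.index n) (X.leaves n) := by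
    rintro s ⟨hs, hs' | ⟨i, hi, rfl⟩⟩
    · exact Or.inl hs'
    · exact pair_mem_block.2 ⟨rfl, by simpa [leaves, hs, Nat.lt_succ_iff] using hi⟩
  have hcard : (X.nth n).ncard = n + 3 := by
    obtain ⟨f, -⟩ := X.index_spec.iso n
    have := Nat.card_congr f
    rw [Nat.card_coe_set_eq, Nat.card_coe_set_eq, subT_eq_block n, ncard_block] at this
    simpa [nth] using this
  have hle := Set.ncard_le_ncard hsub (block_finite _ _)
  rw [ncard_block, hcard] at hle
  obtain ⟨i, hi⟩ : (X.leaves n).Nonempty := Finset.card_pos.1 (by omega)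
  have hmem : ∀ i ∈ X.leaves n, [X.index n, i] ∈ X.1 := fun i hi => by
    simpa using (Finset.mem_filter.1 hi).2
  have h₁ : [X.index n] ∈ X.1 := htree (a := i) (by simpa using hmem i hi)
  have h₀ : [] ∈ X.1 := htree (a := X.index n) (by simpa using h₁)
  have heq : X.nth n = block (X.index n) (X.leaves n) := by
    refine hsub.antisymm ?_
    rw [nth, subT_eq_block]
    refine Set.subset_inter ?_ (block_subset_block.2 ⟨rfl, Finset.filter_subset _ _⟩)
    rintro s ((rfl | rfl) | ⟨i, hi, rfl⟩)
    exacts [h₀, h₁, hmem i hi]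
  refine ⟨heq, ?_⟩
  rw [heq, ncard_block] at hcard
  omega

theorem nth_eq (X : R1) (n : ℕ) : X.nth n = block (X.index n) (X.leaves n) := (X.nth_spec n).1

theorem card_leaves (X : R1) (n : ℕ) : (X.leaves n).card = n + 1 := (X.nth_spec n).2

open Classical in
theorem leaves_subset (X : R1) (n : ℕ) : X.leaves n ⊆ Finset.range (X.index n + 1) :=
  Finset.filter_subset _ _

theorem index_strictMono (X : R1) : StrictMono X.index := X.index_spec.strictMono

theorem coe_eq_iUnion (X : R1) : X.1 = ⋃ n, X.nth n := by
  ext s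
  simp only [Set.mem_iUnion]
  constructor
  · intro hs
    rcases X.2.2.1 hs with (rfl | ⟨j, rfl⟩) | ⟨j, i, hi, rfl⟩
    · exact ⟨0, hs, Or.inl (Or.inl rfl)⟩
    · obtain ⟨n, rfl⟩ := X.index_spec.cover j ⟨[j], ⟨hs, Or.inl (Or.inr rfl)⟩, by simp⟩
      exact ⟨n, hs, Or.inl (Or.inr rfl)⟩
    · obtain ⟨n, rfl⟩ := X.index_spec.cover j ⟨[j, i], ⟨hs, Or.inr ⟨i, hi, rfl⟩⟩, by simp⟩
      exact ⟨n, hs, Or.inr ⟨i, hi, rfl⟩⟩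
  · rintro ⟨n, hn⟩
    exact hn.1

theorem ext_nth {X Y : R1} (h : ∀ n, X.nth n = Y.nth n) : X = Y :=
  Subtype.ext (by rw [coe_eq_iUnion, coe_eq_iUnion, Set.iUnion_congr h])

theorem nth_eq_nth_iff {X Y : R1} {n m : ℕ} :
    X.nth n = Y.nth m ↔ X.index n = Y.index m ∧ X.leaves n = Y.leaves m := by
  rw [nth_eq, nth_eq]
  exact ⟨block_injective, fun h => by rw [h.1, h.2]⟩

theorem nth_subset_nth_iff {X Y : R1} {n m : ℕ} :
    X.nth n ⊆ Y.nth m ↔ X.index n = Y.index m ∧ X.leaves n ⊆ Y.leaves m := by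
  rw [nth_eq, nth_eq, block_subset_block]

theorem exists_of_blocks (k : ℕ → ℕ) (S : ℕ → Finset ℕ) (hk : StrictMono k)
    (hS : ∀ n, S n ⊆ Finset.range (k n + 1)) (hc : ∀ n, (S n).card = n + 1) :
    ∃ X : R1, ∀ n, X.index n = k n ∧ X.leaves n = S n := by
  have hinter : ∀ n, (⋃ m, block (k m) (S m)) ∩ subT (k n) = block (k n) (S n) := by
    intro n
    rw [subT_eq_block]
    apply Set.Subset.antisymm
    · rintro s ⟨hs, (rfl | rfl) | ⟨i, hi, rfl⟩⟩
      · exact nil_mem_block _ _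
      · exact singleton_mem_block.2 rfl
      · obtain ⟨m, hm⟩ := Set.mem_iUnion.1 hs
        obtain ⟨h₁, h₂⟩ := pair_mem_block.1 hm
        obtain rfl := hk.injective h₁
        exact hm
    · exact Set.subset_inter (Set.subset_iUnion (fun m => block (k m) (S m)) n)
        (block_subset_block.2 ⟨rfl, hS n⟩)
  have hidx : IsIndexing (⋃ m, block (k m) (S m)) k := by
    refine ⟨hk, fun n => ?_, ?_⟩
    · rw [hinter, subT_eq_block]
      exact treeIso_block (by simp [hc])
    · rintro j ⟨s, ⟨hs, hj⟩, hne⟩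
      obtain ⟨m, hm⟩ := Set.mem_iUnion.1 hs
      refine ⟨m, ?_⟩
      rw [subT_eq_block] at hj
      rcases hj with (rfl | rfl) | ⟨i, hi, rfl⟩
      · exact absurd rfl hne
      · exact singleton_mem_block.1 hm
      · exact (pair_mem_block.1 hm).1
  have htree : (⋃ m, block (k m) (S m)) ∈ Descriptive.tree ℕ := by
    change ∀ ⦃x : List ℕ⦄ ⦃a : ℕ⦄, x ++ [a] ∈ (⋃ m, block (k m) (S m)) →
      x ∈ (⋃ m, block (k m) (S m))
    intro x a hx
    obtain ⟨m, hm⟩ := Set.mem_iUnion.1 hx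
    refine Set.mem_iUnion.2 ⟨m, ?_⟩
    match x, hm with
    | [], _ => exact nil_mem_block _ _
    | [b], hm => exact singleton_mem_block.2 (pair_mem_block.1 hm).1
    | b :: c :: x, hm => simp [block] at hm
  have hfull : (⋃ m, block (k m) (S m)) ⊆ fullT := by
    intro s hs
    obtain ⟨m, (rfl | rfl) | ⟨i, hi, rfl⟩⟩ := Set.mem_iUnion.1 hs
    · exact Or.inl (Or.inl rfl)
    · exact Or.inl (Or.inr ⟨_, rfl⟩)
    · exact Or.inr ⟨_, i, Nat.lt_succ_iff.1 (Finset.mem_range.1 (hS m hi)), rfl⟩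
  let X : R1 := ⟨_, htree, hfull, k, hidx⟩
  refine ⟨X, fun n => ?_⟩
  have hX : X.index = k := X.index_spec.unique hidx
  have := X.nth_eq n
  rw [nth, hX] at this
  obtain ⟨-, h⟩ := block_injective ((hinter n).symm.trans this)
  exact ⟨by rw [hX], h.symm⟩

theorem mem_r {X : R1} {n : ℕ} {s : List ℕ} : s ∈ X.r n ↔ ∃ i < n, s ∈ X.nth i := by
  simp [r]

theorem singleton_mem_r {X : R1} {n j : ℕ} : [j] ∈ X.r n ↔ ∃ i < n, X.index i = j := by
  simp [mem_r, nth_eq, singleton_mem_block, eq_comm]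

theorem r_succ (X : R1) (n : ℕ) : X.r (n + 1) = X.r n ∪ X.nth n := by
  ext s
  simp only [mem_r, Set.mem_union, Nat.lt_succ_iff_lt_or_eq]
  grind

theorem r_finite (X : R1) (n : ℕ) : (X.r n).Finite := by
  refine Set.Finite.biUnion (Set.finite_lt_nat n) fun i _ => ?_
  rw [nth_eq]
  exact block_finite _ _

theorem r_inter_subT (X : R1) {n i : ℕ} (hi : i < n) : X.r n ∩ subT (X.index i) = X.nth i := by
  refine Set.Subset.antisymm (Set.inter_subset_inter_left _ fun s hs => ?_)
    (Set.subset_inter (fun s hs => mem_r.2 ⟨i, hi, hs⟩) Set.inter_subset_right)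
  obtain ⟨j, -, hj⟩ := mem_r.1 hs
  exact hj.1

/-- The nodes `[j]` of length one reveal the set of indices, and two increasing enumerations of one
finite set coincide. Intersecting with `subT` then recovers each tree. -/
theorem r_eq_r_iff {X Y : R1} {n m : ℕ} :
    X.r n = Y.r m ↔ n = m ∧ ∀ i < n, X.nth i = Y.nth i := by
  constructor
  · intro h
    have himg : (Finset.range n).image X.index = (Finset.range m).image Y.index := by
      ext j
      have : [j] ∈ X.r n ↔ [j] ∈ Y.r m := by rw [h]
      simpa [singleton_mem_r] using this
    have hcard := congrArg Finset.card himg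
    rw [Finset.card_image_of_injective _ X.index_strictMono.injective,
      Finset.card_image_of_injective _ Y.index_strictMono.injective, Finset.card_range,
      Finset.card_range] at hcard
    subst hcard
    refine ⟨rfl, ?_⟩
    have hidx : ∀ i < n, X.index i = Y.index i := by
      have hX : StrictMono fun i : Fin n => X.index i := fun a b hab => X.index_strictMono hab
      have hY : StrictMono fun i : Fin n => Y.index i := fun a b hab => Y.index_strictMono hab
      have hr : Set.range (fun i : Fin n => X.index i) = Set.range fun i : Fin n => Y.index i := by
        ext j
        have := Finset.ext_iff.1 himg j
        simpa [Fin.exists_iff] using this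
      exact fun i hi => congrFun ((StrictMono.range_inj hX hY).1 hr) ⟨i, hi⟩
    intro i hi
    rw [← r_inter_subT X hi, ← r_inter_subT Y hi, h, hidx i hi]
  · rintro ⟨rfl, h⟩
    ext s
    simp only [mem_r]
    exact exists_congr fun i => and_congr_right fun hi => by rw [h i hi]

theorem r_eq_r_of_le {X Y : R1} {n m : ℕ} (hnm : n ≤ m) (h : X.r m = Y.r m) : X.r n = Y.r n :=
  r_eq_r_iff.2 ⟨rfl, fun i hi => (r_eq_r_iff.1 h).2 i (by omega)⟩

/-- Monotonicity of the witness is automatic: inclusion of trees forces equal indices, and indices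
increase. -/
theorem le_iff_nth {Y X : R1} : le Y X ↔ ∀ i, ∃ j, Y.nth i ⊆ X.nth j := by
  constructor
  · rintro ⟨k, -, h⟩ i
    exact ⟨k i, h i⟩
  · intro h
    choose k hk using h
    refine ⟨k, fun a b hab => ?_, hk⟩
    have ha := (nth_subset_nth_iff.1 (hk a)).1
    have hb := (nth_subset_nth_iff.1 (hk b)).1
    rw [← X.index_strictMono.lt_iff_lt, ← ha, ← hb]
    exact Y.index_strictMono hab

theorem leFin_r_iff {Y X : R1} {n m : ℕ} :
    leFin (Y.r n) (X.r m) ↔ ∀ i < n, ∃ j < m, Y.nth i ⊆ X.nth j := by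
  constructor
  · rintro ⟨n', m', Y', X', -, hY, hX, k, -, h⟩ i hi
    obtain ⟨rfl, hY'⟩ := r_eq_r_iff.1 hY
    obtain ⟨rfl, hX'⟩ := r_eq_r_iff.1 hX
    refine ⟨k ⟨i, hi⟩, (k _).2, ?_⟩
    rw [hY' i hi, hX' _ (k _).2]
    exact h ⟨i, hi⟩
  · intro h
    choose k hkm hk using h
    let k' : Fin n → Fin m := fun i => ⟨k i i.2, hkm i i.2⟩
    have hmono : StrictMono k' := fun a b hab => by
      have ha := (nth_subset_nth_iff.1 (hk a a.2)).1
      have hb := (nth_subset_nth_iff.1 (hk b b.2)).1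
      rw [Fin.lt_def, ← X.index_strictMono.lt_iff_lt]
      change X.index (k a a.2) < X.index (k b b.2)
      rw [← ha, ← hb]
      exact Y.index_strictMono hab
    have hnm : n ≤ m := by simpa using Fintype.card_le_of_injective k' hmono.injective
    exact ⟨n, m, Y, X, hnm, rfl, rfl, k', hmono, fun i => hk i i.2⟩

theorem mem_AR_iff {a : Set (List ℕ)} : a ∈ AR r ↔ ∃ (Y : R1) (n : ℕ), Y.r n = a := by
  simp only [AR, ARn, Set.mem_iUnion, Set.mem_ofPred_eq]
  exact exists_comm

theorem len_r (Y : R1) (n : ℕ) : len r (Y.r n) = n := by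
  have : {m : ℕ | Y.r n ∈ ARn r m} = {n} := by
    ext m
    refine ⟨fun ⟨X, hX⟩ => (r_eq_r_iff.1 hX).1, ?_⟩
    rintro rfl
    exact ⟨Y, rfl⟩
  rw [len, this, csInf_singleton]

/-- The first `n` trees of `X` can be continued by subtrees of trees of `Y` that lie further up,
with leaves in prescribed sets. -/
theorem exists_glue (X Y : R1) (n : ℕ) (g : ℕ → ℕ) (T : ℕ → Finset ℕ) (hg : StrictMono g)
    (hT : ∀ i, T i ⊆ Y.leaves (g i)) (hc : ∀ i, i + 1 ≤ (T i).card)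
    (hlt : ∀ i < n, X.index i < Y.index (g n)) :
    ∃ Z : R1, (∀ i < n, Z.nth i = X.nth i) ∧
      ∀ i ≥ n, Z.index i = Y.index (g i) ∧ Z.leaves i ⊆ T i := by
  choose S hST hS using fun i => Finset.exists_subset_card_eq (hc i)
  have hk : StrictMono fun i => if i < n then X.index i else Y.index (g i) := by
    intro a b hab
    dsimp only
    split_ifs with ha hb hb
    · exact X.index_strictMono hab
    · exact (hlt a ha).trans_le (Y.index_strictMono.monotone (hg.monotone (by omega)))
    · omega
    · exact Y.index_strictMono (hg hab)
  obtain ⟨Z, hZ⟩ := exists_of_blocks (fun i => if i < n then X.index i else Y.index (g i))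
    (fun i => if i < n then X.leaves i else S i) hk
    (fun i => by
      split_ifs
      · exact X.leaves_subset i
      · exact ((hST i).trans (hT i)).trans (Y.leaves_subset _))
    (fun i => by
      split_ifs
      exacts [X.card_leaves i, hS i])
  refine ⟨Z, fun i hi => nth_eq_nth_iff.2 (by simpa [hi] using hZ i), fun i hi => ?_⟩
  obtain ⟨h₁, h₂⟩ := hZ i
  rw [if_neg (by omega)] at h₁ h₂
  exact ⟨h₁, h₂ ▸ hST i⟩

/-- A sequence all of whose initial parts come from members of `R_1` comes from a member. -/
theorem exists_limit (f : ℕ → Set (List ℕ)) (h : ∀ n, ∃ A : R1, ∀ k ≤ n, A.r k = f k) :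
    ∃ A : R1, ∀ n, A.r n = f n := by
  choose A hA using h
  -- The `i`-th tree is settled from stage `i + 1` on.
  have hnth : ∀ n, ∀ i < n, (A n).nth i = (A (i + 1)).nth i := fun n i hi =>
    (r_eq_r_iff.1 ((hA n (i + 1) hi).trans (hA (i + 1) (i + 1) le_rfl).symm)).2 i (by omega)
  have hk : StrictMono fun i => (A (i + 1)).index i := strictMono_nat_of_lt_succ fun i => by
    rw [← (nth_eq_nth_iff.1 (hnth (i + 2) i (by omega))).1]
    exact (A (i + 2)).index_strictMono (by omega)
  obtain ⟨Z, hZ⟩ := exists_of_blocks (fun i => (A (i + 1)).index i)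
    (fun i => (A (i + 1)).leaves i) hk (fun i => leaves_subset _ _) (fun i => card_leaves _ _)
  refine ⟨Z, fun n => ?_⟩
  rw [← hA n n le_rfl, r_eq_r_iff]
  exact ⟨rfl, fun i hi => by rw [hnth n i hi]; exact nth_eq_nth_iff.2 (hZ i)⟩

end R1
-- Depth and closedness for general triples.
theorem depth_eq_iff {R U : Type*} {leFin : U → U → Prop} {r : R → ℕ → U} {B : R} {a : U} {n : ℕ} :
    depth leFin r B a = n ↔ leFin a (r B n) ∧ ∀ m < n, ¬ leFin a (r B m) := by
  constructor
  · intro h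
    have hne : {d : ℕ∞ | ∃ n : ℕ, d = (n : ℕ∞) ∧ leFin a (r B n)}.Nonempty := by
      by_contra hcon
      rw [Set.not_nonempty_iff_eq_empty] at hcon
      rw [depth, hcon, sInf_empty] at h
      exact ENat.natCast_ne_top n h.symm
    obtain ⟨m, hm, hle⟩ := csInf_mem hne
    rw [← depth, h, Nat.cast_inj] at hm
    refine ⟨hm ▸ hle, fun k hk hcon => ?_⟩
    have : depth leFin r B a ≤ k := sInf_le ⟨k, rfl, hcon⟩
    rw [h, Nat.cast_le] at this
    omega
  · rintro ⟨h, hmin⟩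
    refine le_antisymm (sInf_le ⟨n, rfl, h⟩) (le_sInf ?_)
    rintro _ ⟨m, rfl, hm⟩
    rw [Nat.cast_le]
    by_contra hcon
    exact hmin m (by omega) hm

theorem exists_depth_eq {R U : Type*} {leFin : U → U → Prop} {r : R → ℕ → U} {B : R} {a : U}
    (h : ∃ n, leFin a (r B n)) : ∃ n : ℕ, depth leFin r B a = n := by
  classical
  exact ⟨Nat.find h, depth_eq_iff.2 ⟨Nat.find_spec h, fun m hm => Nat.find_min h hm⟩⟩

/-- If all limits of coherent sequences of approximations exist, then the triple is closed. -/
theorem isClosedTriple_of_exists_limit {R U : Type*} {r : R → ℕ → U}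
    (h : ∀ f : ℕ → U, (∀ n, ∃ A : R, ∀ k ≤ n, r A k = f k) → ∃ A : R, ∀ n, r A n = f n) :
    IsClosedTriple r := by
  let _ : TopologicalSpace (AR r) := ⊥
  have : DiscreteTopology (AR r) := ⟨rfl⟩
  refine isClosed_of_closure_subset fun f hf => ?_
  obtain ⟨A, hA⟩ := h (fun n => f n) fun n => by
    have ho : IsOpen (Set.pi (Set.Iic n) fun k => ({f k} : Set (AR r))) :=
      isOpen_set_pi (Set.finite_Iic n) fun k _ => isOpen_discrete _
    obtain ⟨g, hg, A, hA⟩ := mem_closure_iff.1 hf _ ho fun k _ => rfl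
    exact ⟨A, fun k hk => by rw [← hA k, hg k hk]⟩
  exact ⟨A, fun n => (hA n).symm⟩

/-! ### Axioms A.1 to A.3 for `R1`. -/

namespace R1

theorem isQuasiOrdered : IsQuasiOrdered le where
  nonempty := by
    obtain ⟨X, -⟩ := exists_of_blocks id (fun n => Finset.range (n + 1)) strictMono_id
      (fun _ => subset_rfl) (fun _ => Finset.card_range _)
    exact ⟨X⟩
  refl A := le_iff_nth.2 fun i => ⟨i, subset_rfl⟩
  trans A B C hAB hBC := le_iff_nth.2 fun i => by
    obtain ⟨j, hj⟩ := le_iff_nth.1 hAB i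
    obtain ⟨k, hk⟩ := le_iff_nth.1 hBC j
    exact ⟨k, hj.trans hk⟩

theorem axiomA1 : AxiomA1 r where
  zero A := by simp [r]
  sep A B hAB := by
    by_contra! hcon
    exact hAB (ext_nth fun i => (r_eq_r_iff.1 (hcon (i + 1))).2 i (by omega))
  init A B n m h := by
    obtain ⟨rfl, h'⟩ := r_eq_r_iff.1 h
    exact ⟨rfl, fun k hk => r_eq_r_of_le hk.le h⟩

theorem axiomA2 : AxiomA2 le leFin r where
  refl a ha := by
    obtain ⟨Y, n, rfl⟩ := mem_AR_iff.1 ha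
    exact leFin_r_iff.2 fun i hi => ⟨i, hi, subset_rfl⟩
  trans a ha b hb c hc hab hbc := by
    obtain ⟨X, l, rfl⟩ := mem_AR_iff.1 ha
    obtain ⟨Y, m, rfl⟩ := mem_AR_iff.1 hb
    obtain ⟨Z, n, rfl⟩ := mem_AR_iff.1 hc
    refine leFin_r_iff.2 fun i hi => ?_
    obtain ⟨j, hj, hij⟩ := leFin_r_iff.1 hab i hi
    obtain ⟨k, hk, hjk⟩ := leFin_r_iff.1 hbc j hj
    exact ⟨k, hk, hij.trans hjk⟩
  finite b hb := by
    obtain ⟨Y, m, rfl⟩ := mem_AR_iff.1 hb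
    refine (Y.r_finite m).finite_subsets.subset ?_
    rintro a ⟨ha, hab⟩ s hs
    obtain ⟨X, n, rfl⟩ := mem_AR_iff.1 ha
    obtain ⟨i, hi, hsi⟩ := mem_r.1 hs
    obtain ⟨j, hj, hij⟩ := leFin_r_iff.1 hab i hi
    exact mem_r.2 ⟨j, hj, hij hsi⟩
  le_iff A B := by
    rw [le_iff_nth]
    constructor
    · intro h n
      choose k hk using h
      refine ⟨(Finset.range n).sup k + 1, leFin_r_iff.2 fun i hi => ⟨k i, ?_, hk i⟩⟩
      exact Nat.lt_succ_of_le (Finset.le_sup (Finset.mem_range.2 hi))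
    · intro h i
      obtain ⟨m, hm⟩ := h (i + 1)
      obtain ⟨j, -, hj⟩ := leFin_r_iff.1 hm i (by omega)
      exact ⟨j, hj⟩
  init a ha b hb c hc hab hbc := by
    obtain ⟨X, m, n, hmn, rfl, rfl⟩ := hab
    obtain ⟨Z, l, rfl⟩ := mem_AR_iff.1 hc
    rw [leFin_r_iff] at hbc
    obtain ⟨j, hj, hmj⟩ := hbc m hmn
    refine ⟨Z.r j, mem_AR_iff.2 ⟨Z, j, rfl⟩, ⟨Z, j, l, hj, rfl, rfl⟩,
      leFin_r_iff.2 fun i hi => ?_⟩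
    obtain ⟨k, hk, hik⟩ := hbc i (by omega)
    refine ⟨k, ?_, hik⟩
    rw [← Z.index_strictMono.lt_iff_lt, ← (nth_subset_nth_iff.1 hik).1,
      ← (nth_subset_nth_iff.1 hmj).1]
    exact X.index_strictMono hi

theorem mem_basic_r_iff {X Y Z : R1} {n : ℕ} :
    Z ∈ basic le r (X.r n) Y ↔ (∀ i, ∃ j, Z.nth i ⊆ Y.nth j) ∧ ∀ i < n, Z.nth i = X.nth i := by
  refine and_congr le_iff_nth ⟨?_, fun h => ⟨n, r_eq_r_iff.2 ⟨rfl, h⟩⟩⟩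
  rintro ⟨m, hm⟩
  obtain ⟨rfl, h⟩ := r_eq_r_iff.1 hm
  exact h

/-- If `a` has depth `n` in `B`, then trees that properly end-extend `a` lie above `r_n(B)`. -/
theorem le_of_depth_eq {Y B Z A : R1} {p n i j : ℕ} (hd : depth leFin r B (Y.r p) = n)
    (hA : ∀ i < n, A.nth i = B.nth i) (hZY : ∀ i < p, Z.nth i = Y.nth i)
    (hZA : ∀ i < p, ∃ j, Z.nth i ⊆ A.nth j) (hi : p ≤ i) (hij : Z.nth i ⊆ A.nth j) : n ≤ j := by
  by_contra! hjn
  -- Were `j < n`, all trees of `a` would lie in trees of `B` before the `j`-th, so `a` would have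
  -- depth at most `j`.
  refine (depth_eq_iff.1 hd).2 j hjn (leFin_r_iff.2 fun i' hi' => ?_)
  obtain ⟨j', hj'⟩ := hZA i' hi'
  have hlt : j' < j := by
    rw [← A.index_strictMono.lt_iff_lt, ← (nth_subset_nth_iff.1 hj').1,
      ← (nth_subset_nth_iff.1 hij).1]
    exact Z.index_strictMono (by omega)
  exact ⟨j', hlt, by rw [← hZY i' hi', ← hA j' (by omega)]; exact hj'⟩

theorem le_of_leFin {Y B : R1} {p n : ℕ} (h : leFin (Y.r p) (B.r n)) : p ≤ n := by
  obtain ⟨p', n', Y', B', hle, hY, hB, -⟩ := h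
  rw [(r_eq_r_iff.1 hY).1, (r_eq_r_iff.1 hB).1]
  exact hle

theorem basic_nonempty_of_depth_eq {Y A B : R1} {p n : ℕ} (hd : depth leFin r B (Y.r p) = n)
  (hA : A ∈ basic le r (B.r n) B) : (basic le r (Y.r p) A).Nonempty := by
  obtain ⟨hAB, hA⟩ := mem_basic_r_iff.1 hA
  have hle := (depth_eq_iff.1 hd).1
  have hpn := le_of_leFin hle
  rw [leFin_r_iff] at hle
  -- The shift `n - p` makes the continuation start in the `n`-th tree of `A`, above every tree that
  -- contains part of `a`.
  obtain ⟨Z, hZ₁, hZ₂⟩ := exists_glue Y A p (fun i => i + (n - p))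
    (fun i => A.leaves (i + (n - p))) (fun a b hab => by simpa using hab) (fun i => subset_rfl)
    (fun i => by rw [card_leaves]; omega) (fun i hi => by
      obtain ⟨j, hj, hij⟩ := hle i hi
      rw [← hA j hj] at hij
      rw [(nth_subset_nth_iff.1 hij).1]
      exact A.index_strictMono (by omega))
  refine ⟨Z, mem_basic_r_iff.2 ⟨fun i => ?_, hZ₁⟩⟩
  rcases lt_or_ge i p with hi | hi
  · obtain ⟨j, hj, hij⟩ := hle i hi
    exact ⟨j, by rw [hZ₁ i hi, hA j hj]; exact hij⟩
  · exact ⟨_, nth_subset_nth_iff.2 (hZ₂ i hi)⟩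
-- For amalgamation, `A'` copies `B` up to the depth `n` and then uses subtrees of `A`. Trees of a
-- member of `[a, A']` beyond `a` sit at or above position `n`, hence inside trees of `A`.
theorem axiomA3 : AxiomA3 le leFin r where
  nonempty a ha B n hd A hA := by
    obtain ⟨Y, p, rfl⟩ := mem_AR_iff.1 ha
    exact basic_nonempty_of_depth_eq hd hA
  amalg a ha A B hAB hne := by
    obtain ⟨Y, p, rfl⟩ := mem_AR_iff.1 ha
    obtain ⟨C, hC⟩ := hne
    obtain ⟨hCA, hCY⟩ := mem_basic_r_iff.1 hC
    rw [le_iff_nth] at hAB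
    obtain ⟨n, hd⟩ : ∃ n : ℕ, depth leFin r B (Y.r p) = n := by
      refine exists_depth_eq ?_
      rw [← r_eq_r_iff.2 ⟨rfl, hCY⟩]
      refine (axiomA2.le_iff C B).1 (le_iff_nth.2 fun i => ?_) p
      obtain ⟨j, hj⟩ := hCA i
      obtain ⟨k, hk⟩ := hAB j
      exact ⟨k, hj.trans hk⟩
    -- Shifting by `B.index n` goes far enough, since the `m`-th index of `A` is at least `m`.
    obtain ⟨Z, hZ₁, hZ₂⟩ := exists_glue B A n (fun i => i + (B.index n))
      (fun i => A.leaves (i + (B.index n))) (fun a b hab => by simpa using hab)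
      (fun i => subset_rfl) (fun i => by rw [card_leaves]; omega) (fun i hi => by
        have h₁ := B.index_strictMono hi
        have h₂ := A.index_strictMono.id_le (n + B.index n)
        simp only [id] at h₂
        omega)
    have hZA : ∀ i ≥ n, Z.nth i ⊆ A.nth (i + B.index n) :=
      fun i hi => nth_subset_nth_iff.2 (hZ₂ i hi)
    have hZB : Z ∈ basic le r (B.r n) B := by
      refine mem_basic_r_iff.2 ⟨fun i => ?_, hZ₁⟩
      rcases lt_or_ge i n with hi | hi
      · exact ⟨i, (hZ₁ i hi).subset⟩
      · obtain ⟨k, hk⟩ := hAB (i + B.index n)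
        exact ⟨k, (hZA i hi).trans hk⟩
    refine ⟨n, hd, Z, hZB, basic_nonempty_of_depth_eq hd hZB, fun D hD => ?_⟩
    obtain ⟨hDZ, hDY⟩ := mem_basic_r_iff.1 hD
    refine mem_basic_r_iff.2 ⟨fun i => ?_, hDY⟩
    rcases lt_or_ge i p with hi | hi
    · rw [hDY i hi, ← hCY i hi]
      exact hCA i
    · obtain ⟨j, hj⟩ := hDZ i
      have := le_of_depth_eq hd hZ₁ hDY (fun i _ => hDZ i) hi hj
      exact ⟨_, hj.trans (hZA j this)⟩

/-! ### Axiom A.4 for `R1`. -/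

/-- Among subsets of cofinitely many leaf sets of `B` one finds large subsets that are homogeneous
for all colourings, with a single colour. -/
theorem exists_homogeneous (B : R1) (n q : ℕ) (c : ℕ → Finset ℕ → Prop) :
    ∃ (g : ℕ → ℕ) (T : ℕ → Finset ℕ), StrictMono g ∧ n ≤ g 0 ∧ (∀ i, T i ⊆ B.leaves (g i)) ∧
      (∀ i, i + 1 ≤ (T i).card) ∧
      ((∀ i, ∀ U ⊆ T i, U.card = q → c (g i) U) ∨ ∀ i, ∀ U ⊆ T i, U.card = q → ¬ c (g i) U) := by
  choose N hN using fun m => exists_ramsey_number (α := ℕ) q (m + 1) (m + 1)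
  -- Partial sums make `g` increasing and give the tree `g i` at least `N i` leaves.
  let g : ℕ → ℕ := fun i => n + ∑ j ∈ Finset.range (i + 1), (N j + 1)
  have hg : StrictMono g := strictMono_nat_of_lt_succ fun i => by
    simp only [g, Finset.sum_range_succ _ (i + 1)]
    omega
  have hNg : ∀ i, N i ≤ (B.leaves (g i)).card := fun i => by
    rw [card_leaves]
    simp only [g, Finset.sum_range_succ _ i]
    omega
  have hT : ∀ i, ∃ T ⊆ B.leaves (g i), T.card = i + 1 ∧
      ((∀ U ⊆ T, U.card = q → c (g i) U) ∨ ∀ U ⊆ T, U.card = q → ¬ c (g i) U) := fun i => by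
    rcases hN i _ (c (g i)) (hNg i) with ⟨T, h₁, h₂, h₃⟩ | ⟨T, h₁, h₂, h₃⟩
    exacts [⟨T, h₁, h₂, Or.inl h₃⟩, ⟨T, h₁, h₂, Or.inr h₃⟩]
  choose T hTB hTc hT using hT
  have hfin : ∀ φ : ℕ → ℕ, StrictMono φ → StrictMono (g ∘ φ) ∧ n ≤ (g ∘ φ) 0 ∧
      (∀ i, (T ∘ φ) i ⊆ B.leaves ((g ∘ φ) i)) ∧ ∀ i, i + 1 ≤ ((T ∘ φ) i).card :=
    fun φ hφ => ⟨hg.comp hφ, Nat.le_add_right _ _, fun i => hTB _, fun i => by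
      simpa [hTc] using hφ.id_le i⟩
  -- The colour may vary with the tree; one colour occurs infinitely often, and a subsequence `φ`
  -- still has large sets because `i ≤ φ i`.
  have hor : (∃ᶠ i in Filter.atTop, ∀ U ⊆ T i, U.card = q → c (g i) U) ∨
      ∃ᶠ i in Filter.atTop, ∀ U ⊆ T i, U.card = q → ¬ c (g i) U :=
    Filter.frequently_or_distrib.1 (Filter.Frequently.of_forall hT)
  rcases hor with h | h
  · obtain ⟨φ, hφ, h⟩ := Filter.extraction_of_frequently_atTop h
    obtain ⟨h₁, h₂, h₃, h₄⟩ := hfin φ hφ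
    exact ⟨_, _, h₁, h₂, h₃, h₄, Or.inl h⟩
  · obtain ⟨φ, hφ, h⟩ := Filter.extraction_of_frequently_atTop h
    obtain ⟨h₁, h₂, h₃, h₄⟩ := hfin φ hφ
    exact ⟨_, _, h₁, h₂, h₃, h₄, Or.inr h⟩

theorem axiomA4 : AxiomA4 le leFin r := by
  intro a ha B n hd O _
  obtain ⟨Y, p, rfl⟩ := mem_AR_iff.1 ha
  rw [len_r]
  obtain ⟨g, T, hg, hng, hTB, hTc, hT⟩ := exists_homogeneous B n (p + 1)
    fun j U => Y.r p ∪ block (B.index j) U ∈ O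
  obtain ⟨A, hA₁, hA₂⟩ := exists_glue B B n g T hg hTB hTc fun i hi =>
    B.index_strictMono (lt_of_lt_of_le hi (hng.trans (hg.monotone (Nat.zero_le n))))
  refine ⟨A, mem_basic_r_iff.2 ⟨fun i => ?_, hA₁⟩, ?_⟩
  · rcases lt_or_ge i n with hi | hi
    · exact ⟨i, (hA₁ i hi).subset⟩
    · exact ⟨_, nth_subset_nth_iff.2 ⟨(hA₂ i hi).1, (hA₂ i hi).2.trans (hTB i)⟩⟩
  -- A one-step extension of `a` adds a single tree, whose `p + 1` leaves lie in `T j` because depth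
  -- forces it past the first `n` trees of `A`.
  have key : ∀ b ∈ rImage leFin r (p + 1) (Y.r p) A, ∃ j, ∃ U ⊆ T j, U.card = p + 1 ∧
      b = Y.r p ∪ block (B.index (g j)) U := by
    rintro b ⟨⟨Z', hZ'⟩, ⟨Z, p', q, -, hp, rfl⟩, m, hm⟩
    obtain ⟨rfl, hZY⟩ := r_eq_r_iff.1 hp
    obtain ⟨rfl, -⟩ := r_eq_r_iff.1 hZ'
    rw [leFin_r_iff] at hm
    obtain ⟨j, -, hj⟩ := hm p' (by omega)
    have hnj : n ≤ j := le_of_depth_eq hd hA₁ hZY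
      (fun i hi => (hm i (by omega)).imp fun _ h => h.2) le_rfl hj
    obtain ⟨h₁, h₂⟩ := nth_subset_nth_iff.1 hj
    refine ⟨j, Z.leaves p', h₂.trans (hA₂ j hnj).2, Z.card_leaves _, ?_⟩
    rw [r_succ, hp, nth_eq, h₁, (hA₂ j hnj).1]
  refine hT.imp (fun h b hb => ?_) fun h b hb => ?_
  · obtain ⟨j, U, hU, hc, rfl⟩ := key b hb
    exact h j U hU hc
  · obtain ⟨j, U, hU, hc, rfl⟩ := key b hb
    exact h j U hU hc

end R1
-- The abstract Ellentuck theorem: basic facts.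
/-- The hypotheses of the abstract Ellentuck theorem; closedness is given as the existence of limits
of coherent sequences of approximations. -/
structure IsEllentuckTriple {R U : Type*} [EmptyCollection U] (le : R → R → Prop)
    (leFin : U → U → Prop) (r : R → ℕ → U) : Prop where
  quasi : IsQuasiOrdered le
  limit : ∀ f : ℕ → U, (∀ n, ∃ A : R, ∀ k ≤ n, r A k = f k) → ∃ A : R, ∀ n, r A n = f n
  a1 : AxiomA1 r
  a2 : AxiomA2 le leFin r
  a3 : AxiomA3 le leFin r
  a4 : AxiomA4 le leFin r

/-- `a` is an initial part of `b`, possibly equal to it. -/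
def Init {R U : Type*} (r : R → ℕ → U) (a b : U) : Prop :=
  ∃ (A : R) (m n : ℕ), m ≤ n ∧ r A m = a ∧ r A n = b

theorem mem_AR {R U : Type*} (r : R → ℕ → U) (A : R) (n : ℕ) : r A n ∈ AR r :=
  Set.mem_iUnion.2 ⟨n, A, rfl⟩

theorem exists_of_mem_AR {R U : Type*} {r : R → ℕ → U} {a : U} (ha : a ∈ AR r) :
    ∃ (A : R) (n : ℕ), r A n = a := by
  obtain ⟨n, A, h⟩ := Set.mem_iUnion.1 ha
  exact ⟨A, n, h⟩

theorem depth_eq_of_agree {R U : Type*} {leFin : U → U → Prop} {r : R → ℕ → U} {A B : R} {b : U}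
    {n : ℕ} (h : ∀ k ≤ n, r B k = r A k) (hd : depth leFin r A b = n) :
    depth leFin r B b = n := by
  rw [depth_eq_iff] at hd ⊢
  exact ⟨by rw [h n le_rfl]; exact hd.1, fun m hm => by rw [h m hm.le]; exact hd.2 m hm⟩

/-- No member below `B` that is compatible with `b` accepts `b`. -/
def Rejects {R U : Type*} (le : R → R → Prop) (r : R → ℕ → U) (S : Set R) (B : R) (b : U) : Prop :=
  ∀ C, le C B → (basic le r b C).Nonempty → ¬ basic le r b C ⊆ S

namespace IsEllentuckTriple

variable {R U : Type*} [EmptyCollection U] {le : R → R → Prop} {leFin : U → U → Prop}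
  {r : R → ℕ → U}

theorem basic_mono (h : IsEllentuckTriple le leFin r) {B C : R} (hBC : le B C) (a : U) :
    basic le r a B ⊆ basic le r a C :=
  fun _ hA => ⟨h.quasi.trans _ _ _ hA.1 hBC, hA.2⟩

theorem mem_basic_self (h : IsEllentuckTriple le leFin r) (A : R) (n : ℕ) :
    A ∈ basic le r (r A n) A :=
  ⟨h.quasi.refl A, n, rfl⟩

theorem agree_of_mem_basic (h : IsEllentuckTriple le leFin r) {A B C : R} {n : ℕ}
    (hB : B ∈ basic le r (r A n) C) : ∀ k ≤ n, r B k = r A k := by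
  obtain ⟨-, m, hm⟩ := hB
  obtain ⟨rfl, h'⟩ := h.a1.init _ _ _ _ hm
  intro k hk
  rcases hk.lt_or_eq with hk | rfl
  exacts [h' k hk, hm]

theorem len_r (h : IsEllentuckTriple le leFin r) (A : R) (n : ℕ) : len r (r A n) = n := by
  have : {m : ℕ | r A n ∈ ARn r m} = {n} := by
    ext m
    refine ⟨fun ⟨X, hX⟩ => (h.a1.init _ _ _ _ hX).1, ?_⟩
    rintro rfl
    exact ⟨A, rfl⟩
  rw [len, this, csInf_singleton]

theorem leFin_of_le (h : IsEllentuckTriple le leFin r) {B C : R} {b : U} {m : ℕ} (hb : b ∈ AR r)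
    (hBC : le B C) (hm : leFin b (r B m)) : ∃ k, leFin b (r C k) := by
  obtain ⟨k, hk⟩ := (h.a2.le_iff B C).1 hBC m
  exact ⟨k, h.a2.trans _ hb _ (mem_AR r B m) _ (mem_AR r C k) hm hk⟩

theorem leFin_of_mem_basic (h : IsEllentuckTriple le leFin r) {A C : R} {a : U}
    (hC : C ∈ basic le r a A) : ∃ k, leFin a (r A k) := by
  obtain ⟨hle, n, rfl⟩ := hC
  exact (h.a2.le_iff C A).1 hle n

theorem basic_nonempty (h : IsEllentuckTriple le leFin r) {A B : R} {a : U} (ha : a ∈ AR r) {n : ℕ}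
    (hd : depth leFin r A a = n) (hB : B ∈ basic le r (r A n) A) : (basic le r a B).Nonempty :=
  h.a3.nonempty a ha A n hd B hB

/-- Passes from the sets `[depth_A(a), A]` in which the axioms produce members to the sets `[a, A]`
in which the Ramsey property asks for them. -/
theorem exists_mem_basic (h : IsEllentuckTriple le leFin r) {A B : R} {a : U} (ha : a ∈ AR r)
    {n : ℕ} (hd : depth leFin r A a = n) (hB : B ∈ basic le r (r A n) A) :
    ∃ C ∈ basic le r a A, basic le r a C ⊆ basic le r a B := by
  obtain ⟨C, hC⟩ := h.basic_nonempty ha hd hB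
  exact ⟨C, h.basic_mono hB.1 a hC, h.basic_mono hC.1 a⟩

theorem basic_trans (h : IsEllentuckTriple le leFin r) {A B C : R} {n : ℕ}
    (hB : B ∈ basic le r (r A n) A) (hC : C ∈ basic le r (r B n) B) : C ∈ basic le r (r A n) A := by
  rw [h.agree_of_mem_basic hB n le_rfl] at hC
  exact h.basic_mono hB.1 _ hC

theorem exists_le_of_init (h : IsEllentuckTriple le leFin r) {a b : U} (hab : Init r a b) {B : R}
    {p : ℕ} (hb : leFin b (r B p)) : ∃ q ≤ p, leFin a (r B q) := by
  obtain ⟨A, m, n, hmn, rfl, rfl⟩ := hab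
  rcases hmn.lt_or_eq with hmn | rfl
  · obtain ⟨d, -, ⟨C, i, j, hij, rfl, hC⟩, hd⟩ := h.a2.init _ (mem_AR r A m) _ (mem_AR r A n) _
      (mem_AR r B p) ⟨A, m, n, hmn, rfl, rfl⟩ hb
    obtain ⟨rfl, h'⟩ := h.a1.init _ _ _ _ hC
    exact ⟨i, hij.le, h' i hij ▸ hd⟩
  · exact ⟨p, le_rfl, hb⟩

theorem init_trans (h : IsEllentuckTriple le leFin r) {a b c : U} (hab : Init r a b)
    (hbc : StrictInit r b c) : Init r a c := by
  obtain ⟨A, m, n, hmn, rfl, rfl⟩ := hab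
  obtain ⟨B, i, j, hij, hi, rfl⟩ := hbc
  obtain ⟨rfl, h'⟩ := h.a1.init _ _ _ _ hi
  refine ⟨B, m, j, by omega, ?_, rfl⟩
  rcases hmn.lt_or_eq with hmn | rfl
  exacts [h' m hmn, hi]

theorem rImage_mono (h : IsEllentuckTriple le leFin r) {B C : R} (hBC : le B C) (n : ℕ) (a : U) :
    rImage leFin r n a B ⊆ rImage leFin r n a C := by
  rintro b ⟨hb, hab, m, hm⟩
  exact ⟨hb, hab, h.leFin_of_le (Set.mem_iUnion.2 ⟨n, hb⟩) hBC hm⟩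

theorem succ_mem_rImage (h : IsEllentuckTriple le leFin r) {B C : R} (hCB : le C B) (n : ℕ) :
    r C (n + 1) ∈ rImage leFin r (len r (r C n) + 1) (r C n) B := by
  rw [h.len_r]
  exact ⟨⟨C, rfl⟩, ⟨C, n, n + 1, n.lt_succ_self, rfl, rfl⟩, (h.a2.le_iff C B).1 hCB _⟩

/-! ### Fusion. -/

/-- Finitely many requirements on approximations of depth `m` can be met at once. -/
theorem exists_forall_depth_eq (h : IsEllentuckTriple le leFin r) {P : U → R → Prop} {Q : U → Prop}
    (hmono : ∀ b B C, le C B → P b B → P b C) (A : R)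
    (hdense : ∀ b ∈ AR r, Q b → ∀ B, le B A → ∀ m : ℕ, depth leFin r B b = m →
      ∃ C ∈ basic le r (r B m) B, P b C) (B : R) (hB : le B A) (m : ℕ) :
    ∃ C ∈ basic le r (r B m) B, ∀ b ∈ AR r, Q b → depth leFin r B b = m → P b C := by
  -- By A.2 only finitely many `b` satisfy `b ≤_fin r_m(B)`. Treating one of them preserves
  -- `r_m(B)`, hence the depth of the others.
  have key : ∀ F : Set U, F.Finite → ∃ C ∈ basic le r (r B m) B,
      ∀ b ∈ F, b ∈ AR r → Q b → depth leFin r B b = m → P b C := by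
    intro F hF
    induction F, hF using Set.Finite.induction_on with
    | empty => exact ⟨B, h.mem_basic_self B m, by simp⟩
    | @insert b F _ _ ih =>
      obtain ⟨C, hC, hF⟩ := ih
      by_cases hb : b ∈ AR r ∧ Q b ∧ depth leFin r B b = m
      · obtain ⟨D, hD, hP⟩ := hdense b hb.1 hb.2.1 C (h.quasi.trans _ _ _ hC.1 hB) m
          (depth_eq_of_agree (h.agree_of_mem_basic hC) hb.2.2)
        refine ⟨D, h.basic_trans hC hD, ?_⟩
        rintro c (rfl | hc) h₁ h₂ h₃
        exacts [hP, hmono _ _ _ hD.1 (hF c hc h₁ h₂ h₃)]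
      · refine ⟨C, hC, ?_⟩
        rintro c (rfl | hc) h₁ h₂ h₃
        exacts [absurd ⟨h₁, h₂, h₃⟩ hb, hF c hc h₁ h₂ h₃]
  obtain ⟨C, hC, hP⟩ := key _ (h.a2.finite (r B m) (mem_AR r B m))
  exact ⟨C, hC, fun b hb hQ hd => hP b ⟨hb, (depth_eq_iff.1 hd).1⟩ hb hQ hd⟩

/-- Fusion: requirements that can be met for single end-extensions of `a` can be met for all
of them. -/
theorem exists_fusion (h : IsEllentuckTriple le leFin r) {P : U → R → Prop}
    (hmono : ∀ b B C, le C B → P b B → P b C) {a : U} {A : R} {n : ℕ}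
    (hd : depth leFin r A a = n)
    (hdense : ∀ b ∈ AR r, Init r a b → ∀ B, le B A → ∀ m : ℕ, depth leFin r B b = m →
      ∃ C ∈ basic le r (r B m) B, P b C) :
    ∃ B ∈ basic le r (r A n) A, ∀ b ∈ AR r, Init r a b → (∃ m, leFin b (r B m)) → P b B := by
  choose! next hnext hP using h.exists_forall_depth_eq hmono A hdense
  let s : ℕ → R := fun k => Nat.rec A (fun k B => next B (n + k)) k
  have hsA : ∀ k, le (s k) A := by
    intro k
    induction k with
    | zero => exact h.quasi.refl A
    | succ k ih => exact h.quasi.trans _ _ _ (hnext (s k) ih (n + k)).1 ih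
  have hs : ∀ k, s (k + 1) ∈ basic le r (r (s k) (n + k)) (s k) :=
    fun k => hnext (s k) (hsA k) (n + k)
  have hle : ∀ k l, k ≤ l → le (s l) (s k) := by
    intro k l hkl
    induction l, hkl using Nat.le_induction with
    | base => exact h.quasi.refl _
    | succ l _ ih => exact h.quasi.trans _ _ _ (hs l).1 ih
  have hagree : ∀ k l, k ≤ l → ∀ j ≤ n + k, r (s l) j = r (s k) j := by
    intro k l hkl j hj
    induction l, hkl using Nat.le_induction with
    | base => rfl
    | succ l _ ih => rw [h.agree_of_mem_basic (hs l) j (by omega), ih]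
  -- The diagonal sequence is coherent since later stages keep the first `n + k` approximations of
  -- `s k`.
  obtain ⟨B, hB⟩ := h.limit (fun j => r (s j) j)
    fun m => ⟨s m, fun k hk => hagree k m hk k (by omega)⟩
  have hBs : ∀ k, ∀ j ≤ n + k, r B j = r (s k) j := by
    intro k j hj
    rw [hB, ← hagree j (max j k) (le_max_left _ _) j (by omega),
      hagree k (max j k) (le_max_right _ _) j hj]
  have hBle : ∀ k, le B (s k) := by
    intro k
    refine (h.a2.le_iff _ _).2 fun j => ?_
    rw [hBs (max j k) j (by omega)]
    exact (h.a2.le_iff _ _).1 (hle k _ (le_max_right _ _)) j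
  have hBA : B ∈ basic le r (r A n) A := ⟨hBle 0, n, hBs 0 n le_rfl⟩
  refine ⟨B, hBA, fun b hb hab hm => ?_⟩
  obtain ⟨p, hp⟩ := exists_depth_eq hm
  obtain ⟨q, hqp, hq⟩ := h.exists_le_of_init hab (depth_eq_iff.1 hp).1
  -- An extension of `a` has depth at least that of `a`, so every `b` is reached at some stage `k`.
  have hnq : n ≤ q := by
    by_contra! hcon
    exact (depth_eq_iff.1 (depth_eq_of_agree (h.agree_of_mem_basic hBA) hd)).2 q hcon hq
  obtain ⟨k, rfl⟩ := Nat.exists_eq_add_of_le (hnq.trans hqp)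
  exact hmono _ _ _ (hBle (k + 1)) (hP (s k) (hsA k) (n + k) b hb hab
    (depth_eq_of_agree (fun j hj => (hBs k j hj).symm) hp))

/-! ### Accepting and rejecting: open sets. -/

/-- Having all large `n`, rather than one, carries the induction on generated open sets through
intersections. -/
theorem exists_basic_subset (h : IsEllentuckTriple le leFin r) {S : Set R}
    (hS : @IsOpen R (ellentuck le r) S) {C : R} (hC : C ∈ S) :
    ∃ N, ∀ n ≥ N, basic le r (r C n) C ⊆ S := by
  induction hS with
  | basic s hs =>
    obtain ⟨b, -, B, rfl⟩ := hs
    obtain ⟨hCB, k, rfl⟩ := hC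
    refine ⟨k, fun n hn D hD => ?_⟩
    exact ⟨h.quasi.trans _ _ _ hD.1 hCB, k, h.agree_of_mem_basic hD k hn⟩
  | univ => exact ⟨0, fun _ _ => Set.subset_univ _⟩
  | inter s t _ _ hs ht =>
    obtain ⟨N, hN⟩ := hs hC.1
    obtain ⟨M, hM⟩ := ht hC.2
    exact ⟨max N M, fun n hn => Set.subset_inter (hN n (le_of_max_le_left hn))
      (hM n (le_of_max_le_right hn))⟩
  | sUnion 𝒮 _ ih =>
    obtain ⟨s, hs, hCs⟩ := hC
    obtain ⟨N, hN⟩ := ih s hs hCs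
    exact ⟨N, fun n hn => (hN n hn).trans (Set.subset_sUnion_of_mem hs)⟩

/-- Some member below `A` accepts or rejects each end-extension of `a` that is below it. -/
theorem exists_forall_decided (h : IsEllentuckTriple le leFin r) (S : Set R) {a : U} {A : R}
    {n : ℕ} (hd : depth leFin r A a = n) :
    ∃ B ∈ basic le r (r A n) A, ∀ b ∈ AR r, Init r a b → (∃ m, leFin b (r B m)) →
      basic le r b B ⊆ S ∨ Rejects le r S B b := by
  refine h.exists_fusion (P := fun b B => basic le r b B ⊆ S ∨ Rejects le r S B b) ?_ hd ?_
  · exact fun b B C hCB hP => hP.imp (fun hP => (h.basic_mono hCB b).trans hP)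
      fun hP D hD => hP D (h.quasi.trans _ _ _ hD hCB)
  · intro b hb _ B _ m hm
    by_cases hrej : Rejects le r S B b
    · exact ⟨B, h.mem_basic_self B m, Or.inr hrej⟩
    · simp only [Rejects, not_forall, not_not] at hrej
      obtain ⟨C, hCB, hne, hCS⟩ := hrej
      -- The accepting `C` need not keep `r_m(B)`; amalgamation replaces it by a `D` that does.
      obtain ⟨m', hm', D, hD, -, hDC⟩ := h.a3.amalg b hb C B hCB hne
      obtain rfl : m = m' := by exact_mod_cast hm.symm.trans hm'
      exact ⟨D, hD, Or.inl (hDC.trans hCS)⟩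

/-- If `a` is rejected, then some member below has all its end-extensions of `a` rejected. -/
theorem exists_forall_rejects (h : IsEllentuckTriple le leFin r) {S : Set R} {a : U} {B : R}
    {n : ℕ} (hd : depth leFin r B a = n)
    (hB : ∀ b ∈ AR r, Init r a b → (∃ m, leFin b (r B m)) →
      basic le r b B ⊆ S ∨ Rejects le r S B b) (ha : Rejects le r S B a) :
    ∃ C ∈ basic le r (r B n) B, ∀ D l, le D C → r D l = a →
      ∀ k, Rejects le r S B (r D (l + k)) := by
  obtain ⟨C, hC, hP⟩ := h.exists_fusion (P := fun b C => Rejects le r S B b →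
    ∀ c ∈ rImage leFin r (len r b + 1) b C, Rejects le r S B c)
    (fun b C D hDC hP hb c hc => hP hb c (h.rImage_mono hDC _ _ hc)) hd (by
      intro b hb hab C hCB m hm
      by_cases hrej : Rejects le r S B b
      swap
      · exact ⟨C, h.mem_basic_self C m, fun hcon => absurd hcon hrej⟩
      obtain ⟨D, hD, hO | hO⟩ := h.a4 b hb C m hm
        {c | c ∈ ARn r (len r b + 1) ∧ basic le r c B ⊆ S} fun c hc => hc.1
      · have hDB := h.quasi.trans _ _ _ hD.1 hCB
        -- If all one-step extensions of `b` were accepted, the sets `[r_{k+1}(E), B]` would cover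
        -- `[b, D]`, and `D` would accept `b`.
        refine absurd ?_ (hrej D hDB (h.basic_nonempty hb hm hD))
        rintro E ⟨hED, k, rfl⟩
        exact (hO (h.succ_mem_rImage hED k)).2 ⟨h.quasi.trans _ _ _ hED hDB, k + 1, rfl⟩
      · refine ⟨D, hD, fun _ c hc => ?_⟩
        have hcAR : c ∈ AR r := Set.mem_iUnion.2 ⟨_, hc.1⟩
        obtain ⟨i, hi⟩ := hc.2.2
        exact (hB c hcAR (h.init_trans hab hc.2.1)
          (h.leFin_of_le hcAR (h.quasi.trans _ _ _ hD.1 hCB) hi)).resolve_left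
          fun hcS => hO hc ⟨hc.1, hcS⟩)
  refine ⟨C, hC, fun D l hD hl k => ?_⟩
  induction k with
  | zero => rwa [add_zero, hl]
  | succ k ih =>
    exact hP _ (mem_AR r D (l + k)) ⟨D, l, l + k, by omega, hl, rfl⟩
      ((h.a2.le_iff D C).1 hD _) ih _ (h.succ_mem_rImage hD _)

theorem exists_decides_of_isOpen (h : IsEllentuckTriple le leFin r) {S : Set R}
    (hS : @IsOpen R (ellentuck le r) S) {a : U} (ha : a ∈ AR r) {A : R} {n : ℕ}
    (hd : depth leFin r A a = n) :
    ∃ B ∈ basic le r (r A n) A, basic le r a B ⊆ S ∨ basic le r a B ∩ S = ∅ := by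
  obtain ⟨B, hB, hdec⟩ := h.exists_forall_decided S hd
  have hdB := depth_eq_of_agree (h.agree_of_mem_basic hB) hd
  have haa : Init r a a := by
    obtain ⟨X, k, rfl⟩ := exists_of_mem_AR ha
    exact ⟨X, k, k, le_rfl, rfl, rfl⟩
  rcases hdec a ha haa ⟨n, (depth_eq_iff.1 hdB).1⟩ with hacc | hrej
  · exact ⟨B, hB, Or.inl hacc⟩
  · obtain ⟨C, hC, hCrej⟩ := h.exists_forall_rejects hdB hdec hrej
    refine ⟨C, h.basic_trans hB hC, Or.inr (Set.eq_empty_of_forall_notMem ?_)⟩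
    rintro D ⟨⟨hDC, l, hl⟩, hDS⟩
    -- A point `D` of the open set would itself accept one of its own approximations extending `a`,
    -- all of which are rejected.
    obtain ⟨N, hN⟩ := h.exists_basic_subset hS hDS
    exact hCrej D l hDC hl N D (h.quasi.trans _ _ _ hDC hC.1) ⟨D, h.mem_basic_self D _⟩
      (hN _ (by omega))

/-! ### Dense open sets, meager sets and the property of Baire. -/

theorem exists_subset_of_dense (h : IsEllentuckTriple le leFin r) {S : Set R}
    (hS : @IsOpen R (ellentuck le r) S) (hS' : @Dense R (ellentuck le r) S) {a : U} (ha : a ∈ AR r)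
    {A : R} {n : ℕ} (hd : depth leFin r A a = n) :
    ∃ B ∈ basic le r (r A n) A, basic le r a B ⊆ S := by
  let _ : TopologicalSpace R := ellentuck le r
  obtain ⟨B, hB, hBS | hBS⟩ := h.exists_decides_of_isOpen hS ha hd
  · exact ⟨B, hB, hBS⟩
  · have := hS'.inter_open_nonempty _
      (TopologicalSpace.isOpen_generateFrom_of_mem ⟨a, ha, B, rfl⟩) (h.basic_nonempty ha hd hB)
    exact absurd hBS this.ne_empty

theorem exists_open_dense_of_isMeagre {X : Type*} [TopologicalSpace X] {S : Set X}
    (hS : IsMeagre S) : ∃ G : ℕ → Set X, (∀ k, IsOpen (G k)) ∧ (∀ k, Dense (G k)) ∧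
      ⋂ k, G k ⊆ Sᶜ := by
  obtain ⟨T, ho, hd, hc, hT⟩ := mem_residual_iff.1 hS
  -- Inserting `univ` makes the family nonempty, so that it can be enumerated by `ℕ`.
  obtain ⟨f, hf⟩ := (hc.insert Set.univ).exists_eq_range (Set.insert_nonempty _ _)
  refine ⟨f, fun k => ?_, fun k => ?_, fun x hx => hT fun t ht => ?_⟩
  · rcases hf.superset ⟨k, rfl⟩ with hk | hk
    exacts [hk ▸ isOpen_univ, ho _ hk]
  · rcases hf.superset ⟨k, rfl⟩ with hk | hk
    exacts [hk ▸ dense_univ, hd _ hk]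
  · obtain ⟨k, rfl⟩ := hf.subset (Set.mem_insert_of_mem _ ht)
    exact Set.mem_iInter.1 hx k

theorem exists_disjoint_of_isMeagre (h : IsEllentuckTriple le leFin r) {S : Set R}
    (hS : IsEllentuckMeager le r S) {a : U} {A : R} {n : ℕ} (hd : depth leFin r A a = n) :
    ∃ B ∈ basic le r (r A n) A, basic le r a B ∩ S = ∅ := by
  let _ : TopologicalSpace R := ellentuck le r
  obtain ⟨f, hfo, hfd, hf⟩ := exists_open_dense_of_isMeagre hS
  -- Treating `b` in the fusion takes one dense open set inside every `f i` with `i ≤ |b|`; lengths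
  -- grow along a member, so it ends up in all `f i`.
  have hG : ∀ k, ∃ G : Set R, IsOpen G ∧ Dense G ∧ ∀ i ≤ k, G ⊆ f i := by
    intro k
    induction k with
    | zero => exact ⟨f 0, hfo 0, hfd 0, fun i hi => by rw [Nat.le_zero.1 hi]⟩
    | succ k ih =>
      obtain ⟨G, hGo, hGd, hG⟩ := ih
      refine ⟨G ∩ f (k + 1), hGo.inter (hfo _), hGd.inter_of_isOpen_left (hfd _) hGo, ?_⟩
      intro i hi
      rcases Nat.le_succ_iff.1 hi with hi | rfl
      exacts [Set.inter_subset_left.trans (hG i hi), Set.inter_subset_right]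
  obtain ⟨B, hB, hP⟩ := h.exists_fusion (P := fun b B => ∀ i ≤ len r b, basic le r b B ⊆ f i)
    (fun b B C hCB hP i hi => (h.basic_mono hCB b).trans (hP i hi)) hd (by
      intro b hb _ B _ m hm
      obtain ⟨G, hGo, hGd, hG⟩ := hG (len r b)
      obtain ⟨C, hC, hCG⟩ := h.exists_subset_of_dense hGo hGd hb hm
      exact ⟨C, hC, fun i hi => hCG.trans (hG i hi)⟩)
  refine ⟨B, hB, Set.eq_empty_of_forall_notMem ?_⟩
  rintro C ⟨⟨hCB, l, hl⟩, hCS⟩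
  refine hf (Set.mem_iInter.2 fun i => ?_) hCS
  exact hP (r C (l + i)) (mem_AR r C _) ⟨C, l, l + i, by omega, hl, rfl⟩
    ((h.a2.le_iff C B).1 hCB _) i (by rw [h.len_r]; omega) ⟨hCB, _, rfl⟩

/-- The abstract Ellentuck theorem. -/
theorem isTopologicalRamseySpace (h : IsEllentuckTriple le leFin r) :
    IsTopologicalRamseySpace le r where
  null S hS a ha A hne := by
    obtain ⟨n, hd⟩ := exists_depth_eq (h.leFin_of_mem_basic hne.some_mem)
    obtain ⟨B, hB, hBS⟩ := h.exists_disjoint_of_isMeagre hS hd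
    obtain ⟨C, hC, hCB⟩ := h.exists_mem_basic ha hd hB
    exact ⟨C, hC, Set.subset_eq_empty (Set.inter_subset_inter_left _ hCB) hBS⟩
  ramsey S hS a ha A hne := by
    obtain ⟨O, hO, hSO⟩ := hS
    obtain ⟨n, hd⟩ := exists_depth_eq (h.leFin_of_mem_basic hne.some_mem)
    obtain ⟨B, hB, hBS⟩ := h.exists_disjoint_of_isMeagre hSO hd
    obtain ⟨C, hC, hCO⟩ := h.exists_decides_of_isOpen hO ha
      (depth_eq_of_agree (h.agree_of_mem_basic hB) hd)
    obtain ⟨D, hD, hDC⟩ := h.exists_mem_basic ha hd (h.basic_trans hB hC)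
    have hiff : ∀ E ∈ basic le r a C, E ∈ S ↔ E ∈ O := by
      intro E hE
      have : E ∉ symmDiff S O := fun hcon =>
        Set.eq_empty_iff_forall_notMem.1 hBS E ⟨h.basic_mono hC.1 a hE, hcon⟩
      rw [Set.mem_symmDiff] at this
      tauto
    refine ⟨D, hD, hCO.imp (fun hCO E hE => (hiff E (hDC hE)).2 (hCO (hDC hE))) fun hCO => ?_⟩
    refine Set.eq_empty_of_forall_notMem fun E hE => ?_
    exact Set.eq_empty_iff_forall_notMem.1 hCO E ⟨hDC hE.1, (hiff E (hDC hE.1)).1 hE.2⟩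

end IsEllentuckTriple

theorem R1.isEllentuckTriple : IsEllentuckTriple R1.le R1.leFin R1.r :=
  ⟨R1.isQuasiOrdered, R1.exists_limit, R1.axiomA1, R1.axiomA2, R1.axiomA3, R1.axiomA4⟩

end RamseySpace

theorem mainTheorem4 :
    RamseySpace.IsQuasiOrdered RamseySpace.R1.le ∧
    RamseySpace.IsClosedTriple RamseySpace.R1.r ∧
    RamseySpace.AxiomA1 RamseySpace.R1.r ∧
    RamseySpace.AxiomA2 RamseySpace.R1.le RamseySpace.R1.leFin RamseySpace.R1.r ∧
    RamseySpace.AxiomA3 RamseySpace.R1.le RamseySpace.R1.leFin RamseySpace.R1.r ∧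
    RamseySpace.AxiomA4 RamseySpace.R1.le RamseySpace.R1.leFin RamseySpace.R1.r ∧
    RamseySpace.IsTopologicalRamseySpace RamseySpace.R1.le RamseySpace.R1.r :=
  ⟨RamseySpace.R1.isQuasiOrdered,
    RamseySpace.isClosedTriple_of_exists_limit RamseySpace.R1.exists_limit,
    RamseySpace.R1.axiomA1, RamseySpace.R1.axiomA2, RamseySpace.R1.axiomA3,
    RamseySpace.R1.axiomA4, RamseySpace.R1.isEllentuckTriple.isTopologicalRamseySpace⟩
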